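/- Let $V$ be a finite set and $n=|V|$. A graph on $V$ is a directed graph $\mathcal G=(V,E)$ whose edge set $E=E(\mathcal G)$ contains all self-loops $i\to i$. It is a \emph{simple DAG} if it contains at most one of $i\to j$, $j\to i$ for all distinct $i,j\in V$ and has no directed cycle of length greater than one. Self-loops are ignored in the sets of parents $\mathrm{pa}(i)$, children $\mathrm{ch}(i)$ and neighbors $\mathrm{ne}(i)=\mathrm{pa}(i)\cup\mathrm{ch}(i)$. The \emph{graphical continuous Lyapunov model} (GCLM) of $\mathcal G$, with uncorrelated noise $C=2I_n$, is the set $\mathcal M_{\mathcal G}$ of all positive definite real matrices $\Sigma$, with rows and columns indexed by $V$, for which there is a real matrix $M$ with all (complex) eigenvalues of strictly negative real part, with $m_{ji}=0$ whenever $i\to j\notin E$, and with $M\Sigma+\Sigma M^T+2I_n=0$. Such a $\Sigma$ represents the normal distribution $\mathcal N(0,\Sigma)$. For $i,j,k\in V$ we write $k\perp\!\!\!\perp\{i,j\}$ if $X_k$ is independent of $(X_i,X_j)$ for $X\sim\mathcal N(0,\Sigma)$ and every $\Sigma\in\mathcal M_{\mathcal G}$. An edge $i\to j$ of a simple DAG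 $\mathcal G$ is \emph{super-covered} if (1) $\mathrm{ch}(i)=\mathrm{ch}(j)\cup\{j\}$ and $\mathrm{pa}(i)\cup\{i\}=\mathrm{pa}(j)$; (2) $k\to l\in E$ for all $k\in\mathrm{pa}(j)$ and $l\in\mathrm{ch}(i)$; and (3) every $k\in V\setminus\{i,j\}$ satisfies $k\in\mathrm{ne}(i)\cap\mathrm{ne}(j)$ or $k\perp\!\!\!\perp\{i,j\}$. A \emph{super-covered edge flip} replaces a super-covered edge $i\to j$ by $j\to i$. \textbf{Theorem.} Let $\mathcal G_1$ and $\mathcal G_2$ be simple DAGs on $V$. Then $\mathcal M_{\mathcal G_1}=\mathcal M_{\mathcal G_2}$ if and only if there is a (finite, possibly empty) sequence of super-covered edge flips, each applied to a simple DAG, that transforms $\mathcal G_1$ into $\mathcal G_2$. Moreover, if $\mathcal M_{\mathcal G_1}=\mathcal M_{\mathcal G_2}$, then $\mathcal G_1$ and $\mathcal G_2$ have the same skeleton (the same edges up to orientation), and $\mathcal G_1$ can be transformed into $\mathcal G_2$ by a sequence of exactly $\delta=|E(\mathcal G_1)\setminus E(\mathcal G_2)|$ super-covered edge flips. -/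

import Mathlib

open MeasureTheory ProbabilityTheory

namespace LyapunovModel

/-! ### Directed graphs

Graphs are Mathlib's `Digraph`s; `G.Adj i j` is the edge `i → j`. Every graph of interest carries
all self-loops, which belong to the edge set but are ignored by parents, children and cycles. -/

section Graph

variable {V : Type*}

/-- The edge set, self-loops included. -/
def edgeSet (G : Digraph V) : Set (V × V) := {e | G.Adj e.1 e.2}

/-- A simple DAG: every vertex has its self-loop, two distinct vertices are joined by at most one
edge, and there is no directed cycle of length greater than one. -/
structure IsSimpleDAG (G : Digraph V) : Prop where
  loops : ∀ i, G.Adj i i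
  simple : ∀ i j, i ≠ j → ¬ (G.Adj i j ∧ G.Adj j i)
  acyclic : ∀ i, ¬ Relation.TransGen (fun a b => a ≠ b ∧ G.Adj a b) i i

/-- Parents of `i`, the vertex `i` itself excluded. -/
def parents (G : Digraph V) (i : V) : Set V := {k | k ≠ i ∧ G.Adj k i}

/-- Children of `i`, the vertex `i` itself excluded. -/
def children (G : Digraph V) (i : V) : Set V := {k | k ≠ i ∧ G.Adj i k}

/-- Neighbors of `i`. -/
def neighbors (G : Digraph V) (i : V) : Set V := parents G i ∪ children G i

/-- Two graphs have the same skeleton: the same edges up to orientation. -/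
def SameSkeleton (G₁ G₂ : Digraph V) : Prop :=
  ∀ i j, (G₁.Adj i j ∨ G₁.Adj j i) ↔ (G₂.Adj i j ∨ G₂.Adj j i)

/-- The graph obtained by replacing the edge `i → j` by `j → i`. -/
def flipEdge (G : Digraph V) (i j : V) : Digraph V where
  Adj a b := (a = j ∧ b = i) ∨ (G.Adj a b ∧ ¬ (a = i ∧ b = j))

end Graph

/-! ### Graphical continuous Lyapunov models -/

section Model

variable {V : Type*} [Fintype V] [DecidableEq V]

/-- A real square matrix is stable if all its complex eigenvalues have negative real part. -/
def IsStable (M : Matrix V V ℝ) : Prop :=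
  ∀ z ∈ spectrum ℂ (M.map (algebraMap ℝ ℂ)), z.re < 0

/-- The graphical continuous Lyapunov model of `G` with volatility matrix `C`, as a set of
covariance matrices. The drift entry `M j i` belongs to the edge `i → j`. -/
def gclmWith (G : Digraph V) (C : Matrix V V ℝ) : Set (Matrix V V ℝ) :=
  {S | S.PosDef ∧ ∃ M : Matrix V V ℝ, (∀ i j, ¬ G.Adj i j → M j i = 0) ∧ IsStable M ∧
    M * S + S * M.transpose + C = 0}

/-- The graphical continuous Lyapunov model with `C = 2 I`. -/
def gclm (G : Digraph V) : Set (Matrix V V ℝ) :=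
  gclmWith G ((2 : ℝ) • (1 : Matrix V V ℝ))

/-- Marginal independence `k ⫫ {i, j}` in the model of `G`: under each centered normal
distribution of the model, the coordinate `X k` is independent of `(X i, X j)`. -/
def MarginallyIndep (G : Digraph V) (k i j : V) : Prop :=
  ∀ S ∈ gclm G, IndepFun (fun x : EuclideanSpace ℝ V => x k)
    (fun x : EuclideanSpace ℝ V => (x i, x j)) (multivariateGaussian 0 S)

/-! ### Super-covered edges -/

/-- The edge `i → j` of `G` is super-covered. -/
structure IsSuperCovered (G : Digraph V) (i j : V) : Prop where
  edge : G.Adj i j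
  children_eq : children G i = children G j ∪ {j}
  parents_eq : parents G i ∪ {i} = parents G j
  parents_children : ∀ k ∈ parents G j, ∀ l ∈ children G i, G.Adj k l
  others : ∀ k, k ≠ i → k ≠ j →
    k ∈ neighbors G i ∩ neighbors G j ∨ MarginallyIndep G k i j

/-- `H` arises from the simple DAG `G` by flipping one super-covered edge. -/
def SuperCoveredFlip (G H : Digraph V) : Prop :=
  IsSimpleDAG G ∧ ∃ i j, IsSuperCovered G i j ∧ H = flipEdge G i j

/-- A sequence of exactly `n` super-covered edge flips transforms `G` into `H`. -/
def FlipSequence (n : ℕ) (G H : Digraph V) : Prop :=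
  ∃ f : ℕ → Digraph V, f 0 = G ∧ f n = H ∧ ∀ t < n, SuperCoveredFlip (f t) (f (t + 1))

end Model

end LyapunovModel

/-!
For positive definite `C`, a positive semidefinite solution of the Lyapunov equation is positive
definite and makes the drift stable, so a model is cut out by a linear condition on the drift.

A super-covered edge `i → j` can be flipped because, for fixed `S`, the drift may be changed by any
`N` with `N S` skew-symmetric. Taking `N S = (S x) (S w)ᵀ - (S w) (S x)ᵀ`, with `w` and `x` the
coefficients of the residuals of `X i` and `X j` after regression on the common parents, produces an
`N` which is supported on edges of the flipped graph and the edge `i → j`, so that a multiple of it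
cancels the entry at `i → j`. Vertices not joined to `i` cause no trouble since they are independent
of `i`, `j` and their parents: two disjoint sets closed under taking parents are uncorrelated, by
uniqueness for a homogeneous Sylvester equation.

Conversely, equality of two models passes to induced subgraphs, as unused vertices can be made
independent standard normal. Inequalities between models of graphs on two and three vertices show
that the models determine the skeleton and the orientation of every edge of an unshielded path.
Among the edges that differ in orientation, choose one whose head `j` is first and then whose tail
`i` is last in the order of the first graph. Acyclicity and four inequalities on four vertices show
that `i → j` is super-covered; flipping it reduces the number of differing edges by one.

A covariance `S` lies outside a model as soon as there is a symmetric `Λ` of nonzero trace such that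
`Λ S` vanishes at all edges: multiplying the Lyapunov equation by `Λ` and taking traces gives
`2 tr Λ = 0`.
-/

namespace LyapunovModel

open Matrix Polynomial

/-! ### The Lyapunov equation -/

section Lyapunov

open scoped ComplexOrder

variable {V : Type*}

lemma posDef_map_algebraMap [Finite V] {S : Matrix V V ℝ} (hS : S.PosDef) :
    (S.map (algebraMap ℝ ℂ)).PosDef := by
  classical
  have := Fintype.ofFinite V
  open scoped MatrixOrder in
  obtain ⟨B, rfl⟩ := CStarAlgebra.nonneg_iff_eq_star_mul_self.mp hS.posSemidef.nonneg
  have hB : (star B * B).map (algebraMap ℝ ℂ) =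
      (B.map (algebraMap ℝ ℂ))ᴴ * B.map (algebraMap ℝ ℂ) := by
    rw [Matrix.map_mul, star_eq_conjTranspose, conjTranspose_map _ fun x => by simp]
  have hpsd := posSemidef_conjTranspose_mul_self (B.map (algebraMap ℝ ℂ))
  rw [← hB] at hpsd
  exact hpsd.posDef_iff_isUnit.2 (hS.isUnit.map (algebraMap ℝ ℂ).mapMatrix)

lemma posDef_two_smul_one [DecidableEq V] : ((2 : ℝ) • (1 : Matrix V V ℝ)).PosDef :=
  PosDef.one.smul two_pos

variable [Fintype V]

/-- A left eigenvector `y` of `M` for `z` turns the Lyapunov equation into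
`2 Re z · (y S y*) = - y C y*`. -/
lemma isStable_of_lyapunov [DecidableEq V] {M S C : Matrix V V ℝ} (hS : S.PosDef) (hC : C.PosDef)
    (h : M * S + S * Mᵀ + C = 0) : IsStable M := by
  intro z hz
  rw [spectrum.mem_iff, isUnit_iff_isUnit_det, isUnit_iff_ne_zero, not_not,
    ← exists_vecMul_eq_zero_iff] at hz
  obtain ⟨y, hy0, hy⟩ := hz
  have heig : y ᵥ* M.map (algebraMap ℝ ℂ) = z • y := by
    rw [vecMul_sub, Algebra.algebraMap_eq_smul_one, vecMul_smul, vecMul_one, sub_eq_zero] at hy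
    exact hy.symm
  have heig' : (M.map (algebraMap ℝ ℂ))ᴴ *ᵥ star y = star z • star y := by
    rw [← star_vecMul, heig, star_smul]
  have hlyap : M.map (algebraMap ℝ ℂ) * S.map (algebraMap ℝ ℂ) +
      S.map (algebraMap ℝ ℂ) * (M.map (algebraMap ℝ ℂ))ᴴ + C.map (algebraMap ℝ ℂ) = 0 := by
    rw [← conjTranspose_map _ fun x => by simp, conjTranspose_eq_transpose_of_trivial]
    simpa only [map_add, map_mul, map_zero, RingHom.mapMatrix_apply] using
      congrArg (algebraMap ℝ ℂ).mapMatrix h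
  have hquad := congrArg (fun A => y ⬝ᵥ A *ᵥ star y) hlyap
  simp only [add_mulVec, dotProduct_add, ← mulVec_mulVec, heig', mulVec_smul, zero_mulVec,
    dotProduct_zero, dotProduct_smul, dotProduct_mulVec y (M.map _), heig, smul_dotProduct,
    smul_eq_mul] at hquad
  have hs := (posDef_map_algebraMap hS).dotProduct_mulVec_pos (star_ne_zero.2 hy0)
  have hc := (posDef_map_algebraMap hC).dotProduct_mulVec_pos (star_ne_zero.2 hy0)
  rw [star_star] at hs hc
  rw [Complex.pos_iff] at hs hc
  have hre := congrArg Complex.re hquad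
  simp only [Complex.add_re, Complex.mul_re, ← hs.2, Complex.star_def, Complex.conj_re, mul_zero,
    sub_zero, Complex.zero_re] at hre
  nlinarith [hs.1, hc.1]

lemma posDef_of_lyapunov {M S C : Matrix V V ℝ} (hS : S.PosSemidef) (hC : C.PosDef)
    (h : M * S + S * Mᵀ + C = 0) : S.PosDef := by
  refine .of_dotProduct_mulVec_pos hS.isHermitian fun x hx => ?_
  refine (hS.dotProduct_mulVec_nonneg x).lt_of_ne' fun h0 => ?_
  have hSx : S *ᵥ x = 0 := (hS.dotProduct_mulVec_zero_iff x).1 h0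
  have hxS : x ᵥ* S = 0 := by
    rw [← mulVec_transpose, ← conjTranspose_eq_transpose_of_trivial, hS.isHermitian, hSx]
  have hquad := congrArg (fun A => x ⬝ᵥ A *ᵥ x) h
  simp only [add_mulVec, ← mulVec_mulVec, hSx, mulVec_zero, zero_add, dotProduct_add,
    dotProduct_mulVec x S, hxS, zero_dotProduct, zero_mulVec, dotProduct_zero] at hquad
  exact (hC.dotProduct_mulVec_pos hx).ne' hquad

lemma mem_gclmWith_iff [DecidableEq V] {G : Digraph V} {C S : Matrix V V ℝ} (hC : C.PosDef) :
    S ∈ gclmWith G C ↔ S.PosSemidef ∧ ∃ M : Matrix V V ℝ, (∀ i j, ¬ G.Adj i j → M j i = 0) ∧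
      M * S + S * Mᵀ + C = 0 := by
  constructor
  · rintro ⟨hS, M, hM, -, hL⟩
    exact ⟨hS.posSemidef, M, hM, hL⟩
  · rintro ⟨hS, M, hM, hL⟩
    have hpd := posDef_of_lyapunov hS hC hL
    exact ⟨hpd, M, hM, isStable_of_lyapunov hpd hC hL, hL⟩

lemma mem_gclm_iff [DecidableEq V] {G : Digraph V} {S : Matrix V V ℝ} :
    S ∈ gclm G ↔ S.PosSemidef ∧ ∃ M : Matrix V V ℝ, (∀ i j, ¬ G.Adj i j → M j i = 0) ∧
      M * S + S * Mᵀ + (2 : ℝ) • (1 : Matrix V V ℝ) = 0 :=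
  mem_gclmWith_iff posDef_two_smul_one

lemma gclm_mono [DecidableEq V] {G H : Digraph V} (h : G ≤ H) : gclm G ⊆ gclm H :=
  fun _ ⟨hS, M, hM, hM'⟩ => ⟨hS, M, fun i j hij => hM i j fun hG => hij (h hG), hM'⟩

end Lyapunov

section Sylvester

variable {m n R : Type*} [Fintype m] [Fintype n] [DecidableEq m] [DecidableEq n]

lemma aeval_mul_eq_mul_aeval [CommRing R] {A : Matrix m m R} {B : Matrix n n R} {X : Matrix m n R}
    (h : A * X = X * B) (p : R[X]) : aeval A p * X = X * aeval B p := by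
  have hpow (k : ℕ) : A ^ k * X = X * B ^ k := by
    induction k with
    | zero => simp
    | succ k ih => rw [pow_succ, Matrix.mul_assoc, h, ← Matrix.mul_assoc, ih, Matrix.mul_assoc,
        ← pow_succ]
  induction p using Polynomial.induction_on' with
  | add p q hp hq => simp [Matrix.add_mul, Matrix.mul_add, hp, hq]
  | monomial k a => simp [aeval_monomial, Algebra.algebraMap_eq_smul_one, hpow]

lemma eq_zero_of_mul_eq_mul_of_isCoprime_charpoly [CommRing R] {A : Matrix m m R}
    {B : Matrix n n R} (hAB : IsCoprime A.charpoly B.charpoly) {X : Matrix m n R}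
    (h : A * X = X * B) : X = 0 := by
  obtain ⟨p, q, hpq⟩ := hAB
  calc
    X = X * aeval B (A.charpoly * p + q * B.charpoly) := by
      rw [mul_comm A.charpoly, hpq, map_one, Matrix.mul_one]
    _ = X * aeval B (A.charpoly * p) := by
      rw [map_add, map_mul _ q, aeval_self_charpoly, mul_zero, add_zero]
    _ = 0 := by
      rw [← aeval_mul_eq_mul_aeval h, map_mul, aeval_self_charpoly, zero_mul, Matrix.zero_mul]

lemma mem_spectrum_map_iff_aeval_charpoly {A : Matrix m m ℝ} {z : ℂ} :
    z ∈ spectrum ℂ (A.map (algebraMap ℝ ℂ)) ↔ aeval z A.charpoly = 0 := by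
  rw [mem_spectrum_iff_isRoot_charpoly, charpoly_map, IsRoot, eval_map_algebraMap]

/-- The spectra of `A` and `-B` lie in opposite open half-planes. -/
lemma IsStable.isCoprime_charpoly_neg {A : Matrix m m ℝ} {B : Matrix n n ℝ} (hA : IsStable A)
    (hB : IsStable B) : IsCoprime A.charpoly (-B).charpoly := by
  refine (isCoprime_iff_aeval_ne_zero_of_isAlgClosed ℝ ℂ _ _).2 fun z => ?_
  by_contra! h
  have hzA := hA z (mem_spectrum_map_iff_aeval_charpoly.2 h.1)
  have hzB : -z ∈ spectrum ℂ (B.map (algebraMap ℝ ℂ)) := by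
    rw [← Set.mem_neg, spectrum.neg_eq, ← Matrix.map_neg _ (by simp)]
    exact mem_spectrum_map_iff_aeval_charpoly.2 h.2
  have := hB _ hzB
  rw [Complex.neg_re] at this
  linarith

lemma IsStable.eq_zero_of_mul_add_mul_eq_zero {A : Matrix m m ℝ} {B : Matrix n n ℝ}
    (hA : IsStable A) (hB : IsStable B) {X : Matrix m n ℝ} (h : A * X + X * B = 0) : X = 0 :=
  eq_zero_of_mul_eq_mul_of_isCoprime_charpoly (hA.isCoprime_charpoly_neg hB)
    (by rw [Matrix.mul_neg, eq_neg_of_add_eq_zero_left h])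

lemma IsStable.transpose {A : Matrix m m ℝ} (hA : IsStable A) : IsStable Aᵀ := fun z hz =>
  hA z <| by rwa [mem_spectrum_map_iff_aeval_charpoly, charpoly_transpose,
    ← mem_spectrum_map_iff_aeval_charpoly] at hz

end Sylvester

section ParentClosed

variable {m n V R : Type*} [Fintype V]

/-- A product only sees the indices in the range of `f` when all other terms vanish. -/
lemma submatrix_mul_submatrix_of_injective [Fintype m] [NonUnitalNonAssocSemiring R]
    {k l k' l' : Type*} {f : m → V} (hf : f.Injective) (A : Matrix k V R) (B : Matrix V l R)
    (r : k' → k) (c : l' → l)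
    (h : ∀ a b, ∀ v ∉ Set.range f, A (r a) v * B v (c b) = 0) :
    A.submatrix r f * B.submatrix f c = (A * B).submatrix r c := by
  ext a b
  exact Fintype.sum_of_injective f hf _ _ (h a b) fun _ => rfl

lemma isStable_submatrix_of_lyapunov [Fintype m] [DecidableEq m] {M S C : Matrix V V ℝ}
    (hS : S.PosDef) (hC : C.PosDef) (hL : M * S + S * Mᵀ + C = 0) {f : m → V} (hf : f.Injective)
    (hM : ∀ a, ∀ v ∉ Set.range f, M (f a) v = 0) : IsStable (M.submatrix f f) := by
  refine isStable_of_lyapunov (hS.submatrix hf) (hC.submatrix hf) ?_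
  rw [transpose_submatrix, submatrix_mul_submatrix_of_injective hf _ _ _ _
      fun a b v hv => by rw [hM a v hv, zero_mul],
    submatrix_mul_submatrix_of_injective hf _ _ _ _
      fun a b v hv => by rw [transpose_apply, hM b v hv, mul_zero]]
  exact congrArg (submatrix · f f) hL

/-- The covariances between the two blocks solve a homogeneous Sylvester equation. -/
lemma submatrix_eq_zero_of_lyapunov [Finite m] [Finite n] {M S C : Matrix V V ℝ}
    (hS : S.PosDef) (hC : C.PosDef) (hL : M * S + S * Mᵀ + C = 0) {f : m → V} {g : n → V}
    (hf : f.Injective) (hg : g.Injective) (hMf : ∀ a, ∀ v ∉ Set.range f, M (f a) v = 0)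
    (hMg : ∀ b, ∀ v ∉ Set.range g, M (g b) v = 0) (hCfg : C.submatrix f g = 0) :
    S.submatrix f g = 0 := by
  classical
  have := Fintype.ofFinite m
  have := Fintype.ofFinite n
  refine (isStable_submatrix_of_lyapunov hS hC hL hf hMf).eq_zero_of_mul_add_mul_eq_zero
    (isStable_submatrix_of_lyapunov hS hC hL hg hMg).transpose ?_
  rw [transpose_submatrix, submatrix_mul_submatrix_of_injective hf _ _ _ _
      fun a b v hv => by rw [hMf a v hv, zero_mul],
    submatrix_mul_submatrix_of_injective hg _ _ _ _
      fun a b v hv => by rw [transpose_apply, hMg b v hv, mul_zero],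
    ← add_eq_right (b := C.submatrix f g)]
  exact (congrArg (submatrix · f g) hL).trans hCfg.symm

lemma cov_eq_zero_of_parentClosed [DecidableEq V] {G : Digraph V} {S : Matrix V V ℝ}
    (hS : S ∈ gclm G) {Q R : Set V} (hQ : ∀ a b, b ∈ Q → G.Adj a b → a ∈ Q)
    (hR : ∀ a b, b ∈ R → G.Adj a b → a ∈ R) (hQR : Disjoint Q R)
    {q r : V} (hq : q ∈ Q) (hr : r ∈ R) : S q r = 0 := by
  classical
  obtain ⟨hS, M, hM, -, hL⟩ := hS
  have row_eq_zero {T : Set V} (hT : ∀ a b, b ∈ T → G.Adj a b → a ∈ T) (t : T) :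
      ∀ v ∉ Set.range (Subtype.val : T → V), M t v = 0 := by
    rw [Subtype.range_val]
    exact fun v hv => hM v t fun hvt => hv (hT v t t.2 hvt)
  refine congrFun₂ (submatrix_eq_zero_of_lyapunov hS posDef_two_smul_one hL
    (f := (Subtype.val : Q → V)) (g := (Subtype.val : R → V)) Subtype.val_injective
    Subtype.val_injective (row_eq_zero hQ) (row_eq_zero hR) ?_) ⟨q, hq⟩ ⟨r, hr⟩
  ext a b
  simp [one_apply_ne (hQR.ne_of_mem a.2 b.2)]

end ParentClosed

/-! ### Drifts preserving a covariance matrix -/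

section SkewDrift

variable {V : Type*} [Fintype V] {S : Matrix V V ℝ}

lemma exists_vecMul_eqOn (hS : S.PosDef) (P : Set V) (b : V → ℝ) :
    ∃ β : V → ℝ, (∀ v ∉ P, β v = 0) ∧ Set.EqOn (β ᵥ* S) b P := by
  classical
  set T := S.submatrix (Subtype.val : P → V) Subtype.val
  have hunit : IsUnit T.det :=
    (isUnit_iff_isUnit_det _).1 (hS.submatrix Subtype.val_injective).isUnit
  set γ : P → ℝ := (fun p : P => b p) ᵥ* T⁻¹ with hγ
  refine ⟨Function.extend Subtype.val γ 0,
    fun v hv => Function.extend_apply' _ _ _ fun ⟨p, hp⟩ => hv (hp ▸ p.2), fun p hp => ?_⟩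
  calc
    (Function.extend Subtype.val γ 0 ᵥ* S) p = (γ ᵥ* T) ⟨p, hp⟩ := by
      refine (Fintype.sum_of_injective Subtype.val Subtype.val_injective _ _ (fun v hv => ?_)
        fun v => ?_).symm
      · rw [Function.extend_apply' _ _ _ hv, Pi.zero_apply, zero_mul]
      · rw [Subtype.val_injective.extend_apply]
        rfl
    _ = b p := by rw [hγ, vecMul_vecMul, nonsing_inv_mul _ hunit, vecMul_one]

/-- `w` gives the residual of `X v` after regression on `X P`. -/
lemma exists_residual (hS : S.PosDef) {P : Set V} {v : V} (hv : v ∉ P) :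
    ∃ w : V → ℝ, w v = 1 ∧ (∀ u ∉ P, u ≠ v → w u = 0) ∧ (∀ p ∈ P, (w ᵥ* S) p = 0) ∧
      0 < (w ᵥ* S) v := by
  classical
  obtain ⟨β, hβ, hβ'⟩ := exists_vecMul_eqOn hS P (S v)
  set w := Pi.single v 1 - β with hw
  have hwv : w v = 1 := by simp [hw, hβ v hv]
  have hwu : ∀ u ∉ P, u ≠ v → w u = 0 := fun u hu huv => by simp [hw, hβ u hu, huv]
  have hwp : ∀ p ∈ P, (w ᵥ* S) p = 0 := fun p hp => by simp [hw, sub_vecMul, hβ' hp]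
  refine ⟨w, hwv, hwu, hwp, ?_⟩
  have hpos := hS.dotProduct_mulVec_pos (x := w) fun h => by simp [h] at hwv
  rw [star_trivial, dotProduct_mulVec, dotProduct, Finset.sum_eq_single v, hwv, mul_one] at hpos
  · exact hpos
  · intro u _ huv
    by_cases hu : u ∈ P
    · rw [hwp u hu, zero_mul]
    · rw [hwu u hu huv, mul_zero]
  · simp

/-- With `w`, `x` the residuals of `X i`, `X j` on `X P`, the drift `N = (S x) wᵀ - (S w) xᵀ` makes
`N S` skew-symmetric. -/
lemma exists_skew_drift (hS : S.PosDef) {P : Set V} {i j : V} (hij : i ≠ j) (hi : i ∉ P)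
    (hj : j ∉ P) :
    ∃ N : Matrix V V ℝ, N * S + S * Nᵀ = 0 ∧ N j i ≠ 0 ∧
      (∀ b ∉ P, b ≠ i → b ≠ j → ∀ a, N a b = 0) ∧ (∀ a ∈ P, ∀ b, N a b = 0) ∧
      ∀ a, (∀ q ∈ P, S q a = 0) → S i a = 0 → S j a = 0 → ∀ b, N a b = 0 := by
  obtain ⟨w, hwi, hw, hwP, -⟩ := exists_residual hS hi
  obtain ⟨x, -, hx, hxP, hxS⟩ := exists_residual hS hj
  have vecMul_eq_zero {y : V → ℝ} (hy : ∀ b ∉ P, b ≠ i → b ≠ j → y b = 0) {a : V}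
      (ha : ∀ q ∈ P, S q a = 0) (hia : S i a = 0) (hja : S j a = 0) : (y ᵥ* S) a = 0 := by
    refine Finset.sum_eq_zero fun q _ => mul_eq_zero.2 (or_iff_not_imp_right.2 fun hqa => ?_)
    exact hy q (hqa <| ha q ·) (by rintro rfl; exact hqa hia) (by rintro rfl; exact hqa hja)
  have hSymm : Sᵀ = S := hS.isHermitian
  have apply_eq (a b : V) : (vecMulVec (x ᵥ* S) w - vecMulVec (w ᵥ* S) x) a b =
      (x ᵥ* S) a * w b - (w ᵥ* S) a * x b := by
    rw [Matrix.sub_apply, vecMulVec_apply, vecMulVec_apply]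
  refine ⟨vecMulVec (x ᵥ* S) w - vecMulVec (w ᵥ* S) x, ?_, ?_, fun b hb hbi hbj a => ?_,
    fun a ha b => ?_, fun a ha hia hja b => ?_⟩
  · rw [transpose_sub, transpose_vecMulVec, transpose_vecMulVec, sub_mul, mul_sub, vecMulVec_mul,
      vecMulVec_mul, mul_vecMulVec, mul_vecMulVec, ← vecMul_transpose, ← vecMul_transpose, hSymm]
    abel
  · rw [apply_eq, hwi, hx i hi hij, mul_one, mul_zero, sub_zero]
    exact hxS.ne'
  · rw [apply_eq, hw b hb hbi, hx b hb hbj, mul_zero, mul_zero, sub_zero]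
  · rw [apply_eq, hwP a ha, hxP a ha, zero_mul, zero_mul, sub_zero]
  · rw [apply_eq, vecMul_eq_zero (fun b hb _ => hx b hb) ha hia hja,
      vecMul_eq_zero (fun b hb h _ => hw b hb h) ha hia hja, zero_mul, zero_mul, sub_zero]

end SkewDrift

/-! ### Independence under a Gaussian law -/

section Gaussian

variable {V : Type*} [Fintype V] [DecidableEq V] {S : Matrix V V ℝ}

lemma indepFun_eval_multivariateGaussian_iff (hS : S.PosSemidef) (k i j : V) :
    IndepFun (fun x : EuclideanSpace ℝ V => x k)
      (fun x : EuclideanSpace ℝ V => (x i, x j)) (multivariateGaussian 0 S) ↔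
    S k i = 0 ∧ S k j = 0 := by
  have memLp_eval (v : V) :
      MemLp (fun x : EuclideanSpace ℝ V => x v) 2 (multivariateGaussian 0 S) :=
    (EuclideanSpace.proj (𝕜 := ℝ) v).comp_memLp' IsGaussian.memLp_two_id
  constructor
  · intro h
    rw [← covariance_eval_multivariateGaussian (μ := 0) hS k i,
      ← covariance_eval_multivariateGaussian (μ := 0) hS k j]
    exact ⟨(h.comp measurable_id measurable_fst).covariance_eq_zero (memLp_eval k) (memLp_eval i),
      (h.comp measurable_id measurable_snd).covariance_eq_zero (memLp_eval k) (memLp_eval j)⟩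
  · rintro ⟨hi, hj⟩
    have hgauss : HasGaussianLaw (fun x : EuclideanSpace ℝ V =>
        ((fun _ : Fin 1 => x k), (fun a : Fin 2 => x (![i, j] a)))) (multivariateGaussian 0 S) :=
      (IsGaussian.hasGaussianLaw_id (μ := multivariateGaussian 0 S)).map_fun
        ((ContinuousLinearMap.pi fun _ : Fin 1 => EuclideanSpace.proj (𝕜 := ℝ) k).prod
          (ContinuousLinearMap.pi fun a : Fin 2 => EuclideanSpace.proj (𝕜 := ℝ) (![i, j] a)))
    have hindep := hgauss.indepFun_of_covariance_eval
      (X := fun _ (x : EuclideanSpace ℝ V) => x k)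
      (Y := fun a (x : EuclideanSpace ℝ V) => x (![i, j] a)) fun _ b => by
        rw [covariance_eval_multivariateGaussian hS]
        fin_cases b <;> assumption
    exact hindep.comp (φ := fun y : Fin 1 → ℝ => y 0) (ψ := fun y : Fin 2 → ℝ => (y 0, y 1))
      (by fun_prop) (by fun_prop)

lemma marginallyIndep_iff {G : Digraph V} {k i j : V} :
    MarginallyIndep G k i j ↔ ∀ S ∈ gclm G, S k i = 0 ∧ S k j = 0 :=
  forall₂_congr fun _ hS => indepFun_eval_multivariateGaussian_iff hS.1.posSemidef k i j

end Gaussian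

/-! ### Induced subgraphs -/

section Induced

variable {m V : Type*}

/-- The graph on `m` induced by `G` along `f : m → V`; for injective `f` this is an induced
subgraph of `G`. -/
def inducedGraph (f : m → V) (G : Digraph V) : Digraph m where
  Adj a b := G.Adj (f a) (f b)

variable [Fintype m] [Fintype V] [DecidableEq m] [DecidableEq V] {G H : Digraph V} {f : m → V}

/-- The remaining vertices are made independent standard normal variables. -/
lemma exists_mem_gclm_submatrix_eq (hG : ∀ i, G.Adj i i) (hf : f.Injective) {S : Matrix m m ℝ}
    (hS : S ∈ gclm (inducedGraph f G)) :
    ∃ T ∈ gclm G, T.submatrix f f = S ∧ ∀ a, ∀ v ∉ Set.range f, T (f a) v = 0 := by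
  classical
  obtain ⟨hpd, M, hM, -, hL⟩ := hS
  let e : m ⊕ ↥(Set.range f)ᶜ ≃ V :=
    ((Equiv.ofInjective f hf).sumCongr (Equiv.refl _)).trans (Equiv.Set.sumCompl _)
  have symm_f (a : m) : e.symm (f a) = Sum.inl a := e.symm_apply_eq.2 rfl
  have symm_compl {v : V} (hv : v ∉ Set.range f) : e.symm v = Sum.inr ⟨v, hv⟩ :=
    e.symm_apply_eq.2 rfl
  refine ⟨(fromBlocks S 0 0 1).submatrix e.symm e.symm, mem_gclm_iff.2
    ⟨PosSemidef.submatrix ?_ _, (fromBlocks M 0 0 (-1)).submatrix e.symm e.symm, ?_, ?_⟩, ?_, ?_⟩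
  · let := hpd.isUnit.invertible
    refine (hpd.fromBlocks₁₁ (0 : Matrix m ↥(Set.range f)ᶜ ℝ) 1).2 ?_
    simpa only [conjTranspose_zero, Matrix.zero_mul, Matrix.mul_zero, sub_zero] using .one
  · intro i j hij
    obtain ⟨a | u, rfl⟩ := e.surjective i <;> obtain ⟨b | v, rfl⟩ := e.surjective j
    · simpa using hM a b hij
    · simp
    · simp
    · have huv : u ≠ v := by rintro rfl; exact hij (hG _)
      simp [huv.symm]
  · have hblock : fromBlocks M 0 0 (-1) * fromBlocks S 0 0 1 +
        fromBlocks S 0 0 1 * (fromBlocks M 0 0 (-1))ᵀ +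
        (2 : ℝ) • (1 : Matrix (m ⊕ ↥(Set.range f)ᶜ) (m ⊕ ↥(Set.range f)ᶜ) ℝ) = 0 := by
      rw [← fromBlocks_one, fromBlocks_transpose, fromBlocks_multiply, fromBlocks_multiply,
        fromBlocks_smul, fromBlocks_add, fromBlocks_add]
      simp only [Matrix.mul_zero, Matrix.zero_mul, add_zero, zero_add, transpose_zero, smul_zero,
        hL]
      simp [two_smul, add_assoc]
    rw [transpose_submatrix, submatrix_mul_equiv, submatrix_mul_equiv, ← submatrix_one_equiv e.symm]
    exact congrArg (submatrix · e.symm e.symm) hblock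
  · ext a b
    simp [symm_f]
  · intro a v hv
    simp [symm_f, symm_compl hv]

lemma submatrix_mem_gclm_inducedGraph {T : Matrix V V ℝ} (hT : T ∈ gclm H) (hf : f.Injective)
    (h0 : ∀ a, ∀ v ∉ Set.range f, T (f a) v = 0) :
    T.submatrix f f ∈ gclm (inducedGraph f H) := by
  obtain ⟨hpd, N, hN, -, hL⟩ := hT
  have h0' : ∀ a, ∀ v ∉ Set.range f, T v (f a) = 0 := fun a v hv => by
    rw [← hpd.isHermitian.apply, h0 a v hv, star_zero]
  refine mem_gclm_iff.2 ⟨(hpd.submatrix hf).posSemidef, N.submatrix f f,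
    fun i j hij => hN _ _ hij, ?_⟩
  rw [transpose_submatrix, submatrix_mul_submatrix_of_injective hf _ _ _ _
      fun a b v hv => by rw [h0' b v hv, mul_zero],
    submatrix_mul_submatrix_of_injective hf _ _ _ _
      fun a b v hv => by rw [h0 a v hv, zero_mul],
    ← submatrix_one f hf]
  exact congrArg (submatrix · f f) hL

lemma gclm_inducedGraph_subset (hG : ∀ i, G.Adj i i) (hf : f.Injective) (h : gclm G ⊆ gclm H) :
    gclm (inducedGraph f G) ⊆ gclm (inducedGraph f H) := by
  intro S hS
  obtain ⟨T, hT, rfl, h0⟩ := exists_mem_gclm_submatrix_eq hG hf hS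
  exact submatrix_mem_gclm_inducedGraph (h hT) hf h0

end Induced

/-! ### Small graphs -/

section Certificate

variable {m V : Type*} [Fintype m] [Fintype V] [DecidableEq V] {G H : Digraph V}

/-- Multiply the Lyapunov equation by `Λ` and take traces: the drift only meets the entries of
`Λ S` at the edges of `H`. -/
lemma trace_eq_zero_of_mem_gclm {S Λ : Matrix V V ℝ} (hS : S ∈ gclm H) (hΛ : Λ.IsSymm)
    (h0 : ∀ a b, H.Adj a b → (Λ * S) b a = 0) : Λ.trace = 0 := by
  obtain ⟨hpd, M, hM, -, hL⟩ := hS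
  have hSymm : Sᵀ = S := hpd.isHermitian
  have htrace : (Λ * S * Mᵀ).trace = 0 := by
    simp only [trace, diag_apply, mul_apply (M := Λ * S), transpose_apply]
    refine Finset.sum_eq_zero fun b _ => Finset.sum_eq_zero fun a _ => ?_
    by_cases hab : H.Adj a b
    · rw [h0 a b hab, zero_mul]
    · rw [hM a b hab, mul_zero]
  have htrace' : (Λ * M * S).trace = 0 := by
    rw [← htrace, ← trace_transpose, transpose_mul, transpose_mul, hSymm, hΛ.eq,
      ← Matrix.mul_assoc, trace_mul_comm, Matrix.mul_assoc]
  have hlin := congrArg (fun A => (Λ * A).trace) hL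
  simp only [Matrix.mul_add, trace_add, ← Matrix.mul_assoc, htrace, htrace', Matrix.mul_smul,
    trace_smul, Matrix.mul_one, Matrix.mul_zero, trace_zero, zero_add, smul_eq_mul] at hlin
  linarith

lemma map_intCast_mem_gclm {S M : Matrix V V ℤ} (A : Matrix V m ℤ) (hS : A * Aᵀ = S)
    (hM : ∀ a b, ¬ G.Adj a b → M b a = 0)
    (hL : M * S + S * Mᵀ + (2 : ℤ) • (1 : Matrix V V ℤ) = 0) :
    S.map (Int.castRingHom ℝ) ∈ gclm G := by
  refine mem_gclm_iff.2 ⟨?_, M.map (Int.castRingHom ℝ), fun a b hab => by simp [hM a b hab], ?_⟩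
  · rw [← hS, Matrix.map_mul, transpose_map, ← conjTranspose_eq_transpose_of_trivial]
    exact posSemidef_self_mul_conjTranspose _
  · have := congrArg (Int.castRingHom ℝ).mapMatrix hL
    rw [map_add, map_add, map_mul, map_mul, map_zsmul, map_one, map_zero] at this
    simpa [transpose_map, ofNat_smul_eq_nsmul] using this

/-- Integrality makes all hypotheses decidable. -/
lemma not_gclm_subset_of_certificate {S : Matrix V V ℤ} (hS : S.map (Int.castRingHom ℝ) ∈ gclm G)
    (Λ : Matrix V V ℤ) (hΛ : Λᵀ = Λ) (htr : Λ.trace ≠ 0)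
    (h0 : ∀ a b, H.Adj a b → (Λ * S) b a = 0) : ¬ gclm G ⊆ gclm H := by
  intro h
  refine htr (Int.cast_injective (α := ℝ) ?_)
  rw [Int.cast_zero, ← eq_intCast (Int.castRingHom ℝ), AddMonoidHom.map_trace]
  refine trace_eq_zero_of_mem_gclm (h hS) (IsSymm.map hΛ _) fun a b hab => ?_
  rw [← Matrix.map_mul, map_apply, h0 a b hab, map_zero]

end Certificate

/-- The graph with the self-loops and the listed edges, a pair `(a, b)` standing for `a → b`; it
encodes small graphs so that statements about them can be decided. -/
def ofEdges {V : Type*} (E : List (V × V)) : Digraph V where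
  Adj a b := a = b ∨ (a, b) ∈ E

instance {V : Type*} [DecidableEq V] (E : List (V × V)) : DecidableRel (ofEdges E).Adj :=
  fun _ _ => inferInstanceAs (Decidable (_ ∨ _))

/- In each proof `M` is a drift with covariance `S`, the first explicit factor `A` shows
`S = A Aᵀ` to be positive semidefinite, and the last matrix `Λ` solves the linear system of
`trace_eq_zero_of_mem_gclm` for the second graph. On four vertices, `1 → 2` is flipped. -/
section SmallGraphs

lemma not_gclm_edge_subset_empty : ¬ gclm (ofEdges [((0 : Fin 2), 1)]) ⊆ gclm (ofEdges []) :=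
  not_gclm_subset_of_certificate (map_intCast_mem_gclm (S := !![1, -1; -1, 2])
    (M := !![-1, 0; -3, -2]) !![1, 0; -1, 1] (by decide) (by decide) (by decide))
    !![2, 2; 2, 1] (by decide) (by decide) (by decide)

lemma chain_mem_gclm :
    (!![1, 1, 1; 1, 3, 4; 1, 4, 9] : Matrix (Fin 3) (Fin 3) ℤ).map (Int.castRingHom ℝ) ∈
      gclm (ofEdges [(0, 1), (1, 2)]) :=
  map_intCast_mem_gclm (M := !![-1, 0, 0; 2, -1, 0; 0, 2, -1])
    !![1, 0, 0, 0, 0, 0; 1, 1, 1, 0, 0, 0; 1, 2, 1, 1, 1, 1] (by decide) (by decide) (by decide)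

lemma fork_mem_gclm :
    (!![3, 1, 2; 1, 1, 1; 2, 1, 3] : Matrix (Fin 3) (Fin 3) ℤ).map (Int.castRingHom ℝ) ∈
      gclm (ofEdges [(1, 0), (1, 2)]) :=
  map_intCast_mem_gclm (M := !![-1, 2, 0; 0, -1, 0; 0, 2, -1])
    !![1, 1, 1, 0; 1, 0, 0, 0; 1, 1, 0, 1] (by decide) (by decide) (by decide)

lemma not_gclm_chain_subset_collider :
    ¬ gclm (ofEdges [((0 : Fin 3), 1), (1, 2)]) ⊆ gclm (ofEdges [(0, 1), (2, 1)]) :=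
  not_gclm_subset_of_certificate chain_mem_gclm !![9, 0, -9; 0, 0, 0; -9, 0, 1]
    (by decide) (by decide) (by decide)

lemma not_gclm_chain_subset_fork :
    ¬ gclm (ofEdges [((0 : Fin 3), 1), (1, 2)]) ⊆ gclm (ofEdges [(1, 0), (1, 2)]) :=
  not_gclm_subset_of_certificate chain_mem_gclm !![33, -99, 66; -99, 73, -30; 66, -30, 6]
    (by decide) (by decide) (by decide)

lemma not_gclm_chain_subset_reverse :
    ¬ gclm (ofEdges [((0 : Fin 3), 1), (1, 2)]) ⊆ gclm (ofEdges [(1, 0), (2, 1)]) :=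
  not_gclm_subset_of_certificate chain_mem_gclm !![-99, 297, -198; 297, -135, 27; -198, 27, 10]
    (by decide) (by decide) (by decide)

lemma not_gclm_fork_subset_collider :
    ¬ gclm (ofEdges [((1 : Fin 3), 0), (1, 2)]) ⊆ gclm (ofEdges [(0, 1), (2, 1)]) :=
  not_gclm_subset_of_certificate fork_mem_gclm !![2, 0, -3; 0, 0, 0; -3, 0, 2]
    (by decide) (by decide) (by decide)

lemma not_gclm_diamond_subset_flip :
    ¬ gclm (ofEdges [((1 : Fin 4), 2), (0, 1), (0, 2), (1, 3), (2, 3)]) ⊆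
      gclm (ofEdges [(2, 1), (0, 1), (0, 2), (1, 3), (2, 3)]) :=
  not_gclm_subset_of_certificate (map_intCast_mem_gclm
    (M := !![-1, 0, 0, 0; 0, -1, 0, 0; 2, 2, -1, 0; 0, 2, 0, -1])
    !![1, 0, 0, 0, 0, 0; 0, 1, 0, 0, 0, 0; 1, 1, 1, 1, 1, 0; 0, 1, 1, 0, 0, 1]
    rfl (by decide) (by decide))
    !![13, 4, -13, 84; 4, -8, -4, 12; -13, -4, 13, -24; 84, 12, -24, 12]
    (by decide) (by decide) (by decide)

lemma not_gclm_descendant_subset_flip :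
    ¬ gclm (ofEdges [((1 : Fin 4), 2), (1, 3), (2, 3), (3, 0)]) ⊆
      gclm (ofEdges [(2, 1), (1, 3), (2, 3), (3, 0)]) :=
  not_gclm_subset_of_certificate (map_intCast_mem_gclm
    (M := !![-1, 0, 0, 2; 0, -1, 0, 0; 0, -2, -1, 0; 0, 2, 2, -1])
    !![3, 2, 1, 1, 0; 0, 0, 0, 0, 1; 1, 0, 0, -1, -1; 2, 0, 1, 0, 0]
    rfl (by decide) (by decide))
    !![0, -3, 0, 0; -3, 3, 3, 0; 0, 3, 1, 0; 0, 0, 0, 0]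
    (by decide) (by decide) (by decide)

lemma not_gclm_ancestor_subset_flip :
    ¬ gclm (ofEdges [((1 : Fin 4), 2), (0, 3), (3, 1), (3, 2)]) ⊆
      gclm (ofEdges [(2, 1), (0, 3), (3, 1), (3, 2)]) :=
  not_gclm_subset_of_certificate (map_intCast_mem_gclm
    (M := !![-1, 0, 0, 0; 0, -1, 0, 0; 0, 2, -1, 2; 2, 0, 0, -1])
    !![1, 0, 0, 0; 0, 1, 0, 0; 1, 1, 3, 0; 1, 0, 1, 1]
    rfl (by decide) (by decide))
    !![4, -98, -4, 0; -98, 7, -7, 42; -4, -7, 1, 0; 0, 42, 0, 0]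
    (by decide) (by decide) (by decide)

lemma not_gclm_sibling_subset_flip :
    ¬ gclm (ofEdges [((1 : Fin 4), 2), (3, 0), (3, 1), (3, 2)]) ⊆
      gclm (ofEdges [(2, 1), (3, 0), (3, 1), (3, 2)]) :=
  not_gclm_subset_of_certificate (map_intCast_mem_gclm
    (M := !![-1, 0, 0, 2; 0, -1, 0, 0; 0, 2, -1, 2; 0, 0, 0, -1])
    !![1, 1, 1, 0, 0, 0; 0, 0, 0, 1, 0, 0; 1, 1, 0, 1, 1, 1; 1, 0, 0, 0, 0, 0]
    rfl (by decide) (by decide))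
    !![-1, -30, 2, -1; -30, -10, 10, 20; 2, 10, -3, 1; -1, 20, 1, 0]
    (by decide) (by decide) (by decide)

end SmallGraphs

/-! ### Orientations determined by the model -/

/-- `a` and `b` are joined by an edge in either direction (or equal, in a graph with all
self-loops); `SameSkeleton` compares this relation. -/
def Linked {V : Type*} (G : Digraph V) (a b : V) : Prop := G.Adj a b ∨ G.Adj b a

section Orientation

variable {V : Type*} {G H : Digraph V} {a b c : V}

lemma Linked.symm (h : Linked G a b) : Linked G b a := Or.symm h

lemma injective_of_unshielded (hG : ∀ i, G.Adj i i) (hab : Linked G a b) (hbc : Linked G b c)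
    (hac : ¬ Linked G a c) : Function.Injective ![a, b, c] := by
  have h₁ : a ≠ b := by rintro rfl; exact hac hbc
  have h₂ : b ≠ c := by rintro rfl; exact hac hab
  have h₃ : a ≠ c := by rintro rfl; exact hac (.inl (hG a))
  simp [← List.nodup_ofFn, h₁, h₂, h₃]

variable {m : Type*} {f : m → V}

lemma ofEdges_le_inducedGraph (hG : ∀ i, G.Adj i i) {E : List (m × m)}
    (hE : ∀ e ∈ E, G.Adj (f e.1) (f e.2)) : ofEdges E ≤ inducedGraph f G := by
  rintro a b (rfl | hab)
  exacts [hG _, hE _ hab]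

variable [Fintype V] [DecidableEq V] [Fintype m] [DecidableEq m]

lemma exists_mem_gclm_submatrix_eq_of_ofEdges (hG : ∀ i, G.Adj i i) (hf : f.Injective)
    {E : List (m × m)} (hE : ∀ e ∈ E, G.Adj (f e.1) (f e.2)) {S : Matrix m m ℝ}
    (hS : S ∈ gclm (ofEdges E)) : ∃ T ∈ gclm G, T.submatrix f f = S := by
  obtain ⟨T, hT, hTS, -⟩ :=
    exists_mem_gclm_submatrix_eq hG hf (gclm_mono (ofEdges_le_inducedGraph hG hE) hS)
  exact ⟨T, hT, hTS⟩

lemma gclm_ofEdges_subset (hG : ∀ i, G.Adj i i) (hH : IsSimpleDAG H) (hGH : gclm G ⊆ gclm H)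
    (hf : f.Injective) {E F : List (m × m)} (N : List (m × m))
    (hE : ∀ e ∈ E, G.Adj (f e.1) (f e.2)) (hF : ∀ e ∈ F, H.Adj (f e.1) (f e.2))
    (hN : ∀ e ∈ N, ¬ Linked H (f e.1) (f e.2))
    (hcover : ∀ a b, a = b ∨ (a, b) ∈ F ∨ (b, a) ∈ F ∨ (a, b) ∈ N ∨ (b, a) ∈ N) :
    gclm (ofEdges E) ⊆ gclm (ofEdges F) := by
  have hge : inducedGraph f H ≤ ofEdges F := by
    intro a b hab
    rcases hcover a b with rfl | h | h | h | h
    · exact .inl rfl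
    · exact .inr h
    · by_contra hne
      exact hH.simple _ _ (hf.ne fun hab => hne (.inl hab)) ⟨hab, hF _ h⟩
    · exact absurd (.inl hab) (hN _ h)
    · exact absurd (.inr hab) (hN _ h)
  exact (gclm_mono (ofEdges_le_inducedGraph hG hE)).trans
    ((gclm_inducedGraph_subset hG hf hGH).trans (gclm_mono hge))

lemma Linked.of_gclm_subset (hG : ∀ i, G.Adj i i) (hH : IsSimpleDAG H) (hGH : gclm G ⊆ gclm H)
    (h : Linked G a b) : Linked H a b := by
  wlog hab : G.Adj a b generalizing a b
  · exact (this h.symm (h.resolve_left hab)).symm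
  by_contra hn
  have hne : a ≠ b := by rintro rfl; exact hn (.inl (hH.loops a))
  exact not_gclm_edge_subset_empty <| gclm_ofEdges_subset (f := ![a, b]) hG hH hGH
    (by simp [← List.nodup_ofFn, hne]) [(0, 1)] (by simp [hab]) (by simp) (by simp [hn]) (by decide)

lemma sameSkeleton_of_gclm_eq (hG : IsSimpleDAG G) (hH : IsSimpleDAG H) (hGH : gclm G = gclm H) :
    SameSkeleton G H :=
  fun _ _ => ⟨Linked.of_gclm_subset hG.loops hH hGH.le, Linked.of_gclm_subset hH.loops hG hGH.ge⟩

lemma exists_cov_ne_zero_of_unshielded (hG : ∀ i, G.Adj i i) (hab : Linked G a b) (hbc : G.Adj b c)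
    (hac : ¬ Linked G a c) : ∃ S ∈ gclm G, S a c ≠ 0 := by
  have hf := injective_of_unshielded hG hab (.inl hbc) hac
  rcases hab with hab | hba
  · obtain ⟨S, hS, hSf⟩ := exists_mem_gclm_submatrix_eq_of_ofEdges hG hf
      (by simp [hab, hbc]) chain_mem_gclm
    have hS02 : S a c = 1 := by simpa using congrFun₂ hSf 0 2
    exact ⟨S, hS, by simp [hS02]⟩
  · obtain ⟨S, hS, hSf⟩ := exists_mem_gclm_submatrix_eq_of_ofEdges hG hf
      (by simp [hba, hbc]) fork_mem_gclm
    have hS02 : S a c = 2 := by simpa using congrFun₂ hSf 0 2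
    exact ⟨S, hS, by simp [hS02]⟩

lemma adj_of_chain (hG : ∀ i, G.Adj i i) (hH : IsSimpleDAG H) (hGH : gclm G ⊆ gclm H)
    (hab : G.Adj a b) (hbc : G.Adj b c) (hac : ¬ Linked H a c) : H.Adj a b ∧ H.Adj b c := by
  have hf := injective_of_unshielded hG (.inl hab) (.inl hbc)
    fun h => hac (h.of_gclm_subset hG hH hGH)
  have subset {F : List (Fin 3 × Fin 3)} (hF : ∀ e ∈ F, H.Adj (![a, b, c] e.1) (![a, b, c] e.2)) :=
    gclm_ofEdges_subset (F := F) (E := [(0, 1), (1, 2)]) hG hH hGH hf [(0, 2)]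
      (by simp [hab, hbc]) hF (by simp [hac])
  rcases Linked.of_gclm_subset hG hH hGH (.inl hab) with hab' | hba' <;>
    rcases Linked.of_gclm_subset hG hH hGH (.inl hbc) with hbc' | hcb'
  · exact ⟨hab', hbc'⟩
  · exact absurd (subset (by simp [hab', hcb']) (by decide)) not_gclm_chain_subset_collider
  · exact absurd (subset (by simp [hba', hbc']) (by decide)) not_gclm_chain_subset_fork
  · exact absurd (subset (by simp [hba', hcb']) (by decide)) not_gclm_chain_subset_reverse

lemma adj_of_unshielded (hG : IsSimpleDAG G) (hH : IsSimpleDAG H) (hGH : gclm G = gclm H)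
    (hab : G.Adj a b) (hbc : Linked G b c) (hac : ¬ Linked G a c) : H.Adj a b := by
  have hsk := sameSkeleton_of_gclm_eq hG hH hGH
  have hac' : ¬ Linked H a c := fun h => hac ((hsk a c).2 h)
  rcases hbc with hbc | hcb
  · exact (adj_of_chain hG.loops hH hGH.le hab hbc hac').1
  by_contra hn
  have hba' : H.Adj b a := ((hsk a b).1 (.inl hab)).resolve_left hn
  rcases (hsk b c).1 (.inr hcb) with hbc' | hcb'
  · exact not_gclm_fork_subset_collider <| gclm_ofEdges_subset hH.loops hG hGH.ge
      (injective_of_unshielded hG.loops (.inl hab) (.inr hcb) hac) [(0, 2)]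
      (by simp [hba', hbc']) (by simp [hab, hcb]) (by simp [hac]) (by decide)
  · have hba := (adj_of_chain hH.loops hG hGH.ge hcb' hba' fun h => hac h.symm).2
    exact hG.simple a b (by rintro rfl; exact hn (hH.loops a)) ⟨hab, hba⟩

lemma adj_iff_of_unshielded (hG : IsSimpleDAG G) (hH : IsSimpleDAG H) (hGH : gclm G = gclm H)
    (hab : Linked G a b) (hbc : Linked G b c) (hac : ¬ Linked G a c) :
    (G.Adj a b ↔ H.Adj a b) ∧ (G.Adj b a ↔ H.Adj b a) := by
  have hsk := sameSkeleton_of_gclm_eq hG hH hGH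
  have hmp (h : G.Adj a b) : H.Adj a b := adj_of_unshielded hG hH hGH h hbc hac
  have hmpr (h : H.Adj a b) : G.Adj a b :=
    adj_of_unshielded hH hG hGH.symm h ((hsk b c).1 hbc) fun h => hac ((hsk a c).2 h)
  have hne : a ≠ b := by rintro rfl; exact hac hbc
  have hab' : Linked H a b := (hsk a b).1 hab
  have hsimple := hG.simple a b hne
  have hsimple' := hH.simple a b hne
  grind [Linked]

end Orientation

/-! ### Flipping an isolated cover -/

section Acyclic

variable {V : Type*} {G : Digraph V} {a b c : V}

/-- The edge relation of `G` without the self-loops. -/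
def StrictAdj (G : Digraph V) (a b : V) : Prop := a ≠ b ∧ G.Adj a b

lemma wellFounded_iff_acyclic [Finite V] {r : V → V → Prop} :
    WellFounded r ↔ ∀ a, ¬ Relation.TransGen r a a := by
  constructor
  · exact fun h a => h.transGen.irrefl.irrefl a
  · intro h
    have : Std.Irrefl (Relation.TransGen r) := ⟨h⟩
    exact Subrelation.wf .single (Finite.wellFounded_of_trans_of_irrefl (Relation.TransGen r))

lemma IsSimpleDAG.wellFounded [Finite V] (hG : IsSimpleDAG G) : WellFounded (StrictAdj G) :=
  wellFounded_iff_acyclic.2 hG.acyclic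

lemma IsSimpleDAG.wellFounded_swap [Finite V] (hG : IsSimpleDAG G) :
    WellFounded (Function.swap (StrictAdj G)) :=
  wellFounded_iff_acyclic.2 fun a h => hG.acyclic a (Relation.transGen_swap.1 h)

lemma IsSimpleDAG.not_adj_of_adj_of_adj (hG : IsSimpleDAG G) (hne : a ≠ b) (hab : G.Adj a b)
    (hbc : G.Adj b c) : ¬ G.Adj c a := by
  intro hca
  rcases eq_or_ne b c with rfl | hbc'
  · exact hG.simple a b hne ⟨hab, hca⟩
  rcases eq_or_ne c a with rfl | hca'
  · exact hG.simple c b hne ⟨hab, hbc⟩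
  exact hG.acyclic a (((Relation.TransGen.single ⟨hne, hab⟩).tail ⟨hbc', hbc⟩).tail ⟨hca', hca⟩)

end Acyclic

/-- The graphical form of a super-covered edge `i → j`: condition (3), which refers to the model,
is replaced by the two closure properties that make all vertices not joined to `i` independent of
`i`, `j` and their parents. Self-loops are edges here, so no vertex needs to be excluded in the last
three fields. -/
structure IsIsolatedCover {V : Type*} (G : Digraph V) (i j : V) : Prop where
  ne : i ≠ j
  adj : G.Adj i j
  parent_iff : ∀ k, k ≠ i → k ≠ j → (G.Adj k i ↔ G.Adj k j)
  child_iff : ∀ k, k ≠ i → k ≠ j → (G.Adj i k ↔ G.Adj j k)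
  parent_child : ∀ k l, G.Adj k i → G.Adj i l → G.Adj k l
  parent_closed : ∀ k p, G.Adj k p → G.Adj p i → G.Adj k i
  neighbor_closed : ∀ k x, Linked G x i → G.Adj x k → Linked G k i

section FlipGraph

variable {V : Type*} {G : Digraph V} {i j k : V}

lemma mem_neighbors : k ∈ neighbors G i ↔ k ≠ i ∧ Linked G k i := and_or_left.symm

lemma flipEdge_adj {a b : V} :
    (flipEdge G i j).Adj a b ↔ a = j ∧ b = i ∨ G.Adj a b ∧ ¬ (a = i ∧ b = j) :=
  .rfl

lemma IsIsolatedCover.isSimpleDAG_flipEdge [Finite V] (h : IsIsolatedCover G i j)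
    (hG : IsSimpleDAG G) : IsSimpleDAG (flipEdge G i j) where
  loops a := .inr ⟨hG.loops a, fun ⟨hi, hj⟩ => h.ne (hi.symm.trans hj)⟩
  simple a b hab := by
    have := hG.simple a b hab
    have := h.ne
    grind [flipEdge_adj]
  acyclic := by
    refine wellFounded_iff_acyclic.1 (WellFounded.wellFounded_iff_has_min.2 fun T hT => ?_)
    obtain ⟨m, hmT, hm⟩ := hG.wellFounded.has_min T hT
    by_cases hmin : ∀ x ∈ T, ¬ StrictAdj (flipEdge G i j) x m
    · exact ⟨m, hmT, hmin⟩
    push Not at hmin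
    obtain ⟨x, hxT, hxm, ⟨rfl, rfl⟩ | hxm'⟩ := hmin
    · refine ⟨x, hxT, fun y hyT ⟨hyx, hy⟩ => ?_⟩
      rcases hy with ⟨-, rfl⟩ | ⟨hyx', hym⟩
      · exact hxm rfl
      have hym' : y ≠ m := fun hym' => hym ⟨hym', rfl⟩
      exact hm y hyT ⟨hym', (h.parent_iff y hym' hyx).2 hyx'⟩
    · exact absurd ⟨hxm, hxm'.1⟩ (hm x hxT)

lemma flipEdge_flipEdge (hij : G.Adj i j) (hji : ¬ G.Adj j i) :
    flipEdge (flipEdge G i j) j i = G := by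
  ext a b
  grind [flipEdge_adj]

lemma IsIsolatedCover.not_adj_symm (h : IsIsolatedCover G i j) (hG : IsSimpleDAG G) :
    ¬ G.Adj j i :=
  fun hji => hG.simple i j h.ne ⟨h.adj, hji⟩

lemma IsIsolatedCover.flipEdge (h : IsIsolatedCover G i j) (hG : IsSimpleDAG G) :
    IsIsolatedCover (flipEdge G i j) j i := by
  have hji := h.not_adj_symm hG
  have hij := h.ne
  obtain ⟨-, hadj, hp, hc, hpc, hpcl, hncl⟩ := h
  have hi := hG.loops i
  have hj := hG.loops j
  constructor
  · exact hij.symm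
  · exact .inl ⟨rfl, rfl⟩
  · intro k hkj hki
    grind [flipEdge_adj]
  · intro k hkj hki
    grind [flipEdge_adj]
  · intro k l hk hl
    rcases eq_or_ne k j with rfl | hkj
    · exact hl
    rcases eq_or_ne l j with rfl | hlj
    · exact hk
    have := hp k
    have := hc l
    have := hpc k l
    grind [flipEdge_adj]
  · intro k p hkp hpj
    have := hp k
    have := hp p
    have := hpcl k p
    grind [flipEdge_adj]
  · intro k x hx hxk
    have := hp k
    have := hc k
    have := hp x
    have := hc x
    have := hncl k x
    grind [flipEdge_adj, Linked]

end FlipGraph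

section FlipModel

variable {V : Type*} [Fintype V] [DecidableEq V] {G H : Digraph V} {i j k q : V}

lemma IsSuperCovered.cov_eq_zero (h : IsSuperCovered G i j) (hG : ∀ i, G.Adj i i)
    (hk : ¬ Linked G k i) {S : Matrix V V ℝ} (hS : S ∈ gclm G) : S k i = 0 := by
  have hki : k ≠ i := by rintro rfl; exact hk (.inl (hG k))
  have hkj : k ≠ j := by rintro rfl; exact hk (.inr h.edge)
  exact (marginallyIndep_iff.1 ((h.others k hki hkj).resolve_left
    fun hn => hk (mem_neighbors.1 hn.1).2) S hS).1

lemma IsSuperCovered.isIsolatedCover (h : IsSuperCovered G i j) (hG : IsSimpleDAG G) :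
    IsIsolatedCover G i j where
  ne := (h.parents_eq ▸ .inr rfl : i ∈ parents G j).1
  adj := h.edge
  parent_iff k hki hkj := by
    simpa [parents, hki, hkj] using Set.ext_iff.1 h.parents_eq k
  child_iff k hki hkj := by
    simpa [children, hki, hkj] using Set.ext_iff.1 h.children_eq k
  parent_child k l hk hl := by
    rcases eq_or_ne k i with rfl | hki
    · exact hl
    rcases eq_or_ne l i with rfl | hli
    · exact hk
    exact h.parents_children k (h.parents_eq ▸ .inl ⟨hki, hk⟩) l ⟨hli, hl⟩
  parent_closed k p hkp hp := by
    by_contra hki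
    have hne : k ≠ p := by rintro rfl; exact hki hp
    have hk : ¬ Linked G k i :=
      not_or.2 ⟨hki, fun hik => hG.not_adj_of_adj_of_adj hne hkp hp hik⟩
    obtain ⟨S, hS, hSk⟩ := exists_cov_ne_zero_of_unshielded hG.loops (.inl hkp) hp hk
    exact hSk (h.cov_eq_zero hG.loops hk hS)
  neighbor_closed k x hx hxk := by
    by_contra hk
    obtain ⟨S, hS, hSk⟩ :=
      exists_cov_ne_zero_of_unshielded hG.loops hx.symm hxk fun hik => hk hik.symm
    exact hSk (by rw [← hS.1.isHermitian.apply, h.cov_eq_zero hG.loops hk hS, star_zero])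

/-- The parents of `i` together with `j`, and the vertices not joined to `i`, are two disjoint
sets closed under taking parents. -/
lemma IsIsolatedCover.cov_eq_zero (h : IsIsolatedCover G i j) (hG : ∀ i, G.Adj i i)
    {S : Matrix V V ℝ} (hS : S ∈ gclm G) (hq : G.Adj q i ∨ q = j) (hk : ¬ Linked G k i) :
    S q k = 0 := by
  refine cov_eq_zero_of_parentClosed hS (Q := {q | G.Adj q i ∨ q = j})
    (R := {r | ¬ Linked G r i}) ?_ ?_ ?_ hq hk
  · rintro a b (hb | rfl) hab
    · exact .inl (h.parent_closed a b hab hb)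
    · rcases eq_or_ne a i with rfl | hai
      · exact .inl (hG a)
      rcases eq_or_ne a b with rfl | hab'
      · exact .inr rfl
      exact .inl ((h.parent_iff a hai hab').2 hab)
  · exact fun a b hb hab ha => hb (h.neighbor_closed b a ha hab)
  · rw [Set.disjoint_left]
    rintro q (hq | rfl) hq'
    exacts [hq' (.inl hq), hq' (.inr h.adj)]

lemma IsIsolatedCover.isSuperCovered (h : IsIsolatedCover G i j) (hG : IsSimpleDAG G) :
    IsSuperCovered G i j where
  edge := h.adj
  children_eq := by
    have := h.not_adj_symm hG
    ext k
    grind [children, h.child_iff k, h.adj, h.ne]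
  parents_eq := by
    have := h.not_adj_symm hG
    ext k
    grind [parents, h.parent_iff k, h.adj, h.ne]
  parents_children k hk l hl := by
    rcases eq_or_ne k i with rfl | hki
    · exact hl.2
    exact h.parent_child k l ((h.parent_iff k hki hk.1).2 hk.2) hl.2
  others k hki hkj := by
    by_cases hk : Linked G k i
    · have hkj' : Linked G k j := hk.imp (h.parent_iff k hki hkj).1 (h.child_iff k hki hkj).1
      exact .inl ⟨mem_neighbors.2 ⟨hki, hk⟩, mem_neighbors.2 ⟨hkj, hkj'⟩⟩
    · refine .inr (marginallyIndep_iff.2 fun S hS => ?_)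
      have hSymm := hS.1.isHermitian
      rw [← hSymm.apply, ← hSymm.apply k j, h.cov_eq_zero hG.loops hS (.inl (hG.loops i)) hk,
        h.cov_eq_zero hG.loops hS (.inr rfl) hk, star_zero]
      exact ⟨rfl, rfl⟩

/-- Subtracting a multiple of the skew drift `N` removes the edge `i → j` from the drift. -/
lemma IsIsolatedCover.gclm_subset_flipEdge (h : IsIsolatedCover G i j) (hG : IsSimpleDAG G) :
    gclm G ⊆ gclm (LyapunovModel.flipEdge G i j) := by
  intro S hS
  obtain ⟨hpd, M, hM, -, hL⟩ := id hS
  obtain ⟨N, hN, hNji, hcol, hrow, hcov⟩ := exists_skew_drift hpd (P := parents G i) h.ne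
    (fun hi => hi.1 rfl) (fun hj => h.not_adj_symm hG hj.2)
  refine mem_gclm_iff.2 ⟨hpd.posSemidef, M - (M j i / N j i) • N, fun a b hab => ?_, ?_⟩
  · by_cases hij : a = i ∧ b = j
    · obtain ⟨rfl, rfl⟩ := hij
      simp [hNji]
    have hab' : ¬ G.Adj a b := fun hG => hab (.inr ⟨hG, hij⟩)
    suffices N b a = 0 by simp [hM a b hab', this]
    by_contra hne
    have ha : G.Adj a i ∨ a = j := by
      by_contra ha
      rw [not_or] at ha
      have hai : a ≠ i := by rintro rfl; exact ha.1 (hG.loops a)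
      exact hne (hcol a (fun hp => ha.1 hp.2) hai ha.2 b)
    have hib : G.Adj i b := by
      have hb : Linked G b i := by
        by_contra hb
        have hS0 {q} (hq : G.Adj q i ∨ q = j) : S q b = 0 := h.cov_eq_zero hG.loops hS hq hb
        exact hne (hcov b (fun q hq => hS0 (.inl hq.2)) (hS0 (.inl (hG.loops i)))
          (hS0 (.inr rfl)) a)
      by_contra hib
      have hbi : b ≠ i := by rintro rfl; exact hib (hG.loops b)
      exact hne (hrow b ⟨hbi, hb.resolve_right hib⟩ a)
    rcases ha with ha | rfl
    · exact hab' (h.parent_child a b ha hib)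
    · have hbi : b ≠ i := by rintro rfl; exact hab (.inl ⟨rfl, rfl⟩)
      have hba : b ≠ a := by rintro rfl; exact hab' (hG.loops b)
      exact hab' ((h.child_iff b hbi hba).1 hib)
  · rw [sub_mul, transpose_sub, transpose_smul, mul_sub, smul_mul_assoc, mul_smul_comm]
    linear_combination (norm := module) hL - (M j i / N j i) • hN

lemma IsIsolatedCover.gclm_flipEdge (h : IsIsolatedCover G i j) (hG : IsSimpleDAG G) :
    gclm (LyapunovModel.flipEdge G i j) = gclm G := by
  refine (h.gclm_subset_flipEdge hG).antisymm' ?_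
  have hsub := (h.flipEdge hG).gclm_subset_flipEdge (h.isSimpleDAG_flipEdge hG)
  rwa [flipEdge_flipEdge h.adj (h.not_adj_symm hG)] at hsub

lemma SuperCoveredFlip.gclm_eq (h : SuperCoveredFlip G H) : gclm G = gclm H := by
  obtain ⟨hG, i, j, hij, rfl⟩ := h
  exact ((hij.isIsolatedCover hG).gclm_flipEdge hG).symm

lemma FlipSequence.gclm_eq {n : ℕ} (h : FlipSequence n G H) : gclm G = gclm H := by
  obtain ⟨f, rfl, rfl, hf⟩ := h
  induction n with
  | zero => rfl
  | succ n ih => exact (ih fun t ht => hf t (by omega)).trans (hf n n.lt_succ_self).gclm_eq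

lemma FlipSequence.cons {n : ℕ} {K : Digraph V} (h : SuperCoveredFlip G H)
    (h' : FlipSequence n H K) : FlipSequence (n + 1) G K := by
  obtain ⟨f, rfl, rfl, hf⟩ := h'
  refine ⟨fun t => Nat.casesOn t G f, rfl, rfl, fun t ht => ?_⟩
  cases t with
  | zero => exact h
  | succ t => exact hf t (by omega)

end FlipModel

/-! ### Reducing the number of reversed edges -/

/-- The edge `i → j` of `G` is not an edge of `H`, its head `j` is a first head of such edges
(`first`), and its tail `i` is a last tail of such edges into `j` (`last`). -/
structure IsExtremalReversal {V : Type*} (G H : Digraph V) (i j : V) : Prop where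
  adj : G.Adj i j
  reversed : ¬ H.Adj i j
  first : ∀ k x, x ≠ j → G.Adj x j → G.Adj k x → H.Adj k x
  last : ∀ x, x ≠ i → G.Adj i x → G.Adj x j → H.Adj x j

section Reversal

variable {V : Type*} {G H : Digraph V} {i j k l : V}

lemma injective_of_unlinked (hG : ∀ i, G.Adj i i) (hij : i ≠ j) (hkl : Linked G k l)
    (hli : Linked G l i) (hki : ¬ Linked G k i) (hkj : ¬ Linked G k j) :
    Function.Injective ![k, i, j, l] := by
  have h₁ : k ≠ i := by rintro rfl; exact hki (.inl (hG k))
  have h₂ : k ≠ j := by rintro rfl; exact hkj (.inl (hG k))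
  have h₃ : k ≠ l := by rintro rfl; exact hki hli
  have h₄ : i ≠ l := by rintro rfl; exact hki hkl
  have h₅ : j ≠ l := by rintro rfl; exact hkj hkl
  simp [← List.nodup_ofFn, h₁, h₂, h₃, h₄, h₅, hij]

lemma exists_isExtremalReversal [Finite V] (hG : IsSimpleDAG G) (hGH : ¬ G ≤ H) :
    ∃ i j, IsExtremalReversal G H i j := by
  obtain ⟨a, b, hab⟩ : ∃ a b, G.Adj a b ∧ ¬ H.Adj a b := by
    by_contra! hle
    exact hGH fun a b => hle a b
  obtain ⟨j, ⟨c, hcj⟩, hj⟩ :=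
    hG.wellFounded.has_min {b | ∃ a, G.Adj a b ∧ ¬ H.Adj a b} ⟨b, a, hab⟩
  obtain ⟨i, hij, hi⟩ := hG.wellFounded_swap.has_min {a | G.Adj a j ∧ ¬ H.Adj a j} ⟨c, hcj⟩
  refine ⟨i, j, hij.1, hij.2, fun k x hxj hx hk => ?_, fun x hxi hx hxj => ?_⟩
  · by_contra hkx
    exact hj x ⟨k, hk, hkx⟩ ⟨hxj, hx⟩
  · by_contra hxj'
    exact hi x ⟨hxj, hxj'⟩ ⟨hxi.symm, hx⟩

namespace IsExtremalReversal

lemma ne (h : IsExtremalReversal G H i j) (hH : ∀ i, H.Adj i i) : i ≠ j := by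
  rintro rfl
  exact h.reversed (hH i)

variable [Fintype V] [DecidableEq V]

lemma adj_symm (h : IsExtremalReversal G H i j) (hG : IsSimpleDAG G) (hH : IsSimpleDAG H)
    (hGH : gclm G = gclm H) : H.Adj j i :=
  ((sameSkeleton_of_gclm_eq hG hH hGH i j).1 (.inl h.adj)).resolve_left h.reversed

lemma linked_iff (h : IsExtremalReversal G H i j) (hG : IsSimpleDAG G) (hH : IsSimpleDAG H)
    (hGH : gclm G = gclm H) : Linked G k i ↔ Linked G k j := by
  constructor <;> intro hk <;> by_contra hn
  · exact h.reversed <| (adj_iff_of_unshielded hG hH hGH (.inr h.adj) hk.symm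
      fun hkj => hn hkj.symm).2.1 h.adj
  · exact h.reversed <| (adj_iff_of_unshielded hG hH hGH (.inl h.adj) hk.symm
      fun hki => hn hki.symm).1.1 h.adj

lemma parent_iff (h : IsExtremalReversal G H i j) (hG : IsSimpleDAG G) (hH : IsSimpleDAG H)
    (hGH : gclm G = gclm H) (hki : k ≠ i) (hkj : k ≠ j) : G.Adj k i ↔ G.Adj k j := by
  have hlinked := h.linked_iff hG hH hGH (k := k)
  constructor <;> intro hk
  · exact (hlinked.1 (.inl hk)).resolve_right fun hjk =>
      hG.not_adj_of_adj_of_adj (h.ne hH.loops) h.adj hjk hk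
  · refine (hlinked.2 (.inl hk)).resolve_right fun hik => ?_
    exact hH.not_adj_of_adj_of_adj hki.symm (h.first i k hkj hk hik) (h.last k hki hik hk)
      (h.adj_symm hG hH hGH)

lemma child_iff (h : IsExtremalReversal G H i j) (hG : IsSimpleDAG G) (hH : IsSimpleDAG H)
    (hGH : gclm G = gclm H) (hki : k ≠ i) (hkj : k ≠ j) : G.Adj i k ↔ G.Adj j k := by
  have hlinked := h.linked_iff hG hH hGH (k := k)
  have hparent := h.parent_iff hG hH hGH hki hkj
  have hsimple_i := hG.simple k i hki
  have hsimple_j := hG.simple k j hkj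
  grind [Linked]

lemma parent_child (h : IsExtremalReversal G H i j) (hG : IsSimpleDAG G) (hH : IsSimpleDAG H)
    (hGH : gclm G = gclm H) (hk : G.Adj k i) (hl : G.Adj i l) : G.Adj k l := by
  have hij := h.ne hH.loops
  rcases eq_or_ne k i with rfl | hki
  · exact hl
  rcases eq_or_ne l i with rfl | hli
  · exact hk
  have hkj : k ≠ j := by rintro rfl; exact hG.simple i k hij ⟨h.adj, hk⟩
  have hkj' := (h.parent_iff hG hH hGH hki hkj).1 hk
  rcases eq_or_ne l j with rfl | hlj
  · exact hkj'
  have hlj' := (h.child_iff hG hH hGH hli hlj).1 hl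
  by_contra hkl
  have hn : ¬ Linked G k l := not_or.2 ⟨hkl, hG.not_adj_of_adj_of_adj hki hk hl⟩
  have hn' : ¬ Linked H k l := fun h => hn ((sameSkeleton_of_gclm_eq hG hH hGH k l).2 h)
  have orient {v} (hkv : G.Adj k v) (hvl : G.Adj v l) : H.Adj k v ∧ H.Adj v l :=
    ⟨(adj_iff_of_unshielded hG hH hGH (.inl hkv) (.inl hvl) hn).1.1 hkv,
      (adj_iff_of_unshielded hG hH hGH (.inr hvl) (.inr hkv) fun h => hn h.symm).2.1 hvl⟩
  have hne : k ≠ l := by rintro rfl; exact hkl (hG.loops k)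
  exact not_gclm_diamond_subset_flip <| gclm_ofEdges_subset (f := ![k, i, j, l]) hG.loops hH hGH.le
    (by simp [← List.nodup_ofFn, hki, hkj, hne, hij, hli.symm, hlj.symm]) [(0, 3)]
    (by simp [h.adj, hk, hkj', hl, hlj'])
    (by simp [h.adj_symm hG hH hGH, orient hk hl, orient hkj' hlj']) (by simp [hn']) (by decide)

/-- A path `k`, `l`, `i` with unlinked ends fixes the orientation of all edges among `k`, `i`, `j`,
`l` except `i → j`. -/
lemma gclm_ofEdges_subset_flip (h : IsExtremalReversal G H i j) (hG : IsSimpleDAG G)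
    (hH : IsSimpleDAG H) (hGH : gclm G = gclm H) (hkl : Linked G k l) (hli : Linked G l i)
    (hki : ¬ Linked G k i) {F : List (Fin 4 × Fin 4)}
    (hF : ∀ e ∈ F, G.Adj (![k, i, j, l] e.1) (![k, i, j, l] e.2))
    (hF3 : ∀ e ∈ F, e ∈ [(0, 3), (3, 0), (1, 3), (3, 1), (2, 3), (3, 2)])
    (hcover : ∀ a, a = 3 ∨ (a, 3) ∈ F ∨ (3, a) ∈ F) :
    gclm (ofEdges ((1, 2) :: F)) ⊆ gclm (ofEdges ((2, 1) :: F)) := by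
  have hsk := sameSkeleton_of_gclm_eq hG hH hGH
  have hkj : ¬ Linked G k j := fun hkj => hki ((h.linked_iff hG hH hGH).2 hkj)
  have hlj : Linked G l j := (h.linked_iff hG hH hGH).1 hli
  have orient {v} (hlv : Linked G l v) (hkv : ¬ Linked G k v) :=
    And.intro (adj_iff_of_unshielded hG hH hGH hkl hlv hkv)
      (adj_iff_of_unshielded hG hH hGH hlv.symm hkl.symm fun h => hkv h.symm)
  have orient_i := orient hli hki
  have orient_j := orient hlj hkj
  have hf := injective_of_unlinked hG.loops (h.ne hH.loops) hkl hli hki hkj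
  refine gclm_ofEdges_subset hG.loops hH hGH.le hf [(0, 1), (0, 2)] ?_ ?_ ?_ ?_
  · exact List.forall_mem_cons.2 ⟨h.adj, hF⟩
  · refine List.forall_mem_cons.2 ⟨h.adj_symm hG hH hGH, fun e he => ?_⟩
    have hGe := hF e he
    have he3 := hF3 e he
    simp only [List.mem_cons, List.not_mem_nil, or_false] at he3
    rcases he3 with rfl | rfl | rfl | rfl | rfl | rfl
    exacts [orient_i.1.1.1 hGe, orient_i.1.2.1 hGe, orient_i.2.1.1 hGe, orient_i.2.2.1 hGe,
      orient_j.2.1.1 hGe, orient_j.2.2.1 hGe]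
  · have hki' : ¬ Linked H k i := fun h => hki ((hsk k i).2 h)
    have hkj' : ¬ Linked H k j := fun h => hkj ((hsk k j).2 h)
    simp [hki', hkj']
  · intro a b
    have ha := hcover a
    have hb := hcover b
    fin_cases a <;> fin_cases b <;> grind

lemma parent_closed (h : IsExtremalReversal G H i j) (hG : IsSimpleDAG G) (hH : IsSimpleDAG H)
    (hGH : gclm G = gclm H) (hkl : G.Adj k l) (hli : G.Adj l i) : G.Adj k i := by
  by_contra hki
  have hne : k ≠ l := by rintro rfl; exact hki hli
  have hki' : ¬ Linked G k i := not_or.2 ⟨hki, fun hik => hG.not_adj_of_adj_of_adj hne hkl hli hik⟩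
  have hli' : l ≠ i := by rintro rfl; exact hki hkl
  have hlj' : l ≠ j := by rintro rfl; exact hki' ((h.linked_iff hG hH hGH).2 (.inl hkl))
  have hlj := (h.parent_iff hG hH hGH hli' hlj').1 hli
  exact not_gclm_ancestor_subset_flip <| h.gclm_ofEdges_subset_flip hG hH hGH (.inl hkl) (.inl hli)
    hki' (by simp [hkl, hli, hlj]) (by decide) (by decide)

lemma neighbor_closed (h : IsExtremalReversal G H i j) (hG : IsSimpleDAG G) (hH : IsSimpleDAG H)
    (hGH : gclm G = gclm H) (hli : Linked G l i) (hlk : G.Adj l k) : Linked G k i := by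
  by_contra hki
  have hli' : l ≠ i := by rintro rfl; exact hki (.inr hlk)
  have hlj' : l ≠ j := by rintro rfl; exact hki ((h.linked_iff hG hH hGH).2 (.inr hlk))
  have subset {F : List (Fin 4 × Fin 4)} :=
    h.gclm_ofEdges_subset_flip hG hH hGH (.inr hlk) hli hki (F := F)
  rcases hli with hli | hil
  · have hlj := (h.parent_iff hG hH hGH hli' hlj').1 hli
    exact not_gclm_sibling_subset_flip <|
      subset (by simp [hlk, hli, hlj]) (by decide) (by decide)
  · have hjl := (h.child_iff hG hH hGH hli' hlj').1 hil
    exact not_gclm_descendant_subset_flip <|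
      subset (by simp [hlk, hil, hjl]) (by decide) (by decide)

lemma isIsolatedCover (h : IsExtremalReversal G H i j) (hG : IsSimpleDAG G) (hH : IsSimpleDAG H)
    (hGH : gclm G = gclm H) : IsIsolatedCover G i j where
  ne := h.ne hH.loops
  adj := h.adj
  parent_iff _ := h.parent_iff hG hH hGH
  child_iff _ := h.child_iff hG hH hGH
  parent_child _ _ := h.parent_child hG hH hGH
  parent_closed _ _ := h.parent_closed hG hH hGH
  neighbor_closed _ _ := h.neighbor_closed hG hH hGH

end IsExtremalReversal

end Reversal

section Equivalence

variable {V : Type*} {G H : Digraph V} {i j : V}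

lemma eq_of_le_of_sameSkeleton (hG : ∀ i, G.Adj i i) (hH : IsSimpleDAG H) (hGH : G ≤ H)
    (hsk : SameSkeleton G H) : G = H := by
  refine hGH.antisymm fun a b hab => ?_
  rcases eq_or_ne a b with rfl | hne
  · exact hG a
  · exact ((hsk a b).2 (.inl hab)).resolve_right fun hba => hH.simple a b hne ⟨hab, hGH hba⟩

lemma edgeSet_flipEdge_sdiff (hji : H.Adj j i) :
    edgeSet (flipEdge G i j) \ edgeSet H = (edgeSet G \ edgeSet H) \ {(i, j)} := by
  ext ⟨a, b⟩
  simp only [edgeSet, Set.mem_sdiff, Set.mem_ofPred_eq, flipEdge_adj, Set.mem_singleton_iff,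
    Prod.mk.injEq]
  grind

lemma ncard_edgeSet_sdiff_eq_zero_iff [Finite V] :
    (edgeSet G \ edgeSet H).ncard = 0 ↔ G ≤ H := by
  rw [Set.ncard_eq_zero, Set.sdiff_eq_empty]
  exact ⟨fun h a b hab => @h (a, b) hab, fun h _ hab => h hab⟩

lemma flipSequence_of_gclm_eq [Fintype V] [DecidableEq V] (hG : IsSimpleDAG G)
    (hH : IsSimpleDAG H) (hGH : gclm G = gclm H) :
    FlipSequence (edgeSet G \ edgeSet H).ncard G H := by
  induction hn : (edgeSet G \ edgeSet H).ncard generalizing G with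
  | zero =>
    exact ⟨fun _ => G, rfl, eq_of_le_of_sameSkeleton hG.loops hH
      (ncard_edgeSet_sdiff_eq_zero_iff.1 hn) (sameSkeleton_of_gclm_eq hG hH hGH), by simp⟩
  | succ n ih =>
    obtain ⟨i, j, hr⟩ := exists_isExtremalReversal (H := H) hG fun hle =>
      n.succ_ne_zero (hn.symm.trans (ncard_edgeSet_sdiff_eq_zero_iff.2 hle))
    have hc := hr.isIsolatedCover hG hH hGH
    refine .cons ⟨hG, i, j, hc.isSuperCovered hG, rfl⟩
      (ih (hc.isSimpleDAG_flipEdge hG) ((hc.gclm_flipEdge hG).trans hGH) ?_)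
    rw [edgeSet_flipEdge_sdiff (hr.adj_symm hG hH hGH),
      Set.ncard_sdiff_singleton_of_mem (a := (i, j)) (And.intro hr.adj hr.reversed), hn,
      Nat.add_sub_cancel]

end Equivalence

end LyapunovModel

theorem mainTheorem2 {V : Type*} [Fintype V] [DecidableEq V] (G₁ G₂ : Digraph V)
    (h₁ : LyapunovModel.IsSimpleDAG G₁) (h₂ : LyapunovModel.IsSimpleDAG G₂) :
    (LyapunovModel.gclm G₁ = LyapunovModel.gclm G₂ ↔
      ∃ n : ℕ, LyapunovModel.FlipSequence n G₁ G₂) ∧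
    (LyapunovModel.gclm G₁ = LyapunovModel.gclm G₂ →
      LyapunovModel.SameSkeleton G₁ G₂ ∧
      LyapunovModel.FlipSequence
        (LyapunovModel.edgeSet G₁ \ LyapunovModel.edgeSet G₂).ncard G₁ G₂) :=
  ⟨⟨fun h => ⟨_, LyapunovModel.flipSequence_of_gclm_eq h₁ h₂ h⟩, fun ⟨_, h⟩ => h.gclm_eq⟩,
    fun h => ⟨LyapunovModel.sameSkeleton_of_gclm_eq h₁ h₂ h,
      LyapunovModel.flipSequence_of_gclm_eq h₁ h₂ h⟩⟩
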